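/- Let $k\ge 1$, let $\lambda=(\lambda_1\ge\dots\ge\lambda_k\ge 0)$ be a partition with at most $k$ parts, and put $n=k+\lambda_1$ and $I(\lambda)=\{\lambda_k+1,\lambda_{k-1}+2,\dots,\lambda_1+k\}\subset\{1,\dots,n\}$. The double Schur polynomial is the flag minor $$s_\lambda(x_1,\dots,x_k\,|\,y)=\det\bigl(Z_{ij}\bigr)_{i\in I(\lambda),\,1\le j\le k},\qquad Z_{ij}=\frac{\prod_{1\le b<i}(x_j+y_b)}{\prod_{1\le a<j}(x_j-x_a)},$$ in the variables $x_1,\dots,x_k,y_1,\dots,y_{n-1}$. A subtraction-free arithmetic circuit is a finite sequence of nodes, each of which is an input variable, a positive integer scalar, or the sum, product or quotient of two earlier nodes; it computes the rational function at its last node, and its size is the number of its nodes. Bit complexity is measured on a random access machine which handles nonnegative integers (indices and addresses), charges every integer operation and memory access by the bit lengths of all numbers taking part (a multiplication by the product of the bit lengths), and carries out the nodes of a circuit one after another; the values at the nodes cannot influence the control, and every node is charged $w^2$ bit operations, where $w$ is the bit length of the numbers on which the arithmetic of the circuit is performed. These numbers are taken to be of size $w=O(\log n)$. Theorem. The polynomial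 $s_\lambda(x_1,\dots,x_k\,|\,y)$ can be computed by a subtraction-free arithmetic circuit of size $O(n^3)$, and the bit complexity of the corresponding algorithm is $O(n^3\log^2 n)$. More precisely, there is a single program that, for all $k$ and $\lambda$, given $k$ and $\lambda_1,\dots,\lambda_k$, halts after executing a subtraction-free circuit that has inputs among $x_1,\dots,x_k,y_1,\dots,y_{n-1}$ and positive integers and computes $s_\lambda(x_1,\dots,x_k\,|\,y)$; and for every constant $A$ there is a constant $C$, independent of $k$ and $\lambda$, such that the size of this circuit is at most $Cn^3$ and, with $w=A\,\ell(n)$, the total cost of the run is at most $C\,n^3\,\ell(n)^2$ bit operations, where $\ell(n)=\lfloor\log_2 n\rfloor+1$ is the bit length of $n$. -/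

import Mathlib

namespace DoubleSchur

/-! ## Double Schur polynomials -/

/-- The field `ℚ(x_1, …, x_k, y_1, …, y_m)` of rational functions. -/
abbrev RatFun (k m : ℕ) : Type := FractionRing (MvPolynomial (Fin k ⊕ Fin m) ℚ)

/-- The variable `x_{j+1}` (indices in the code start at `0`). -/
noncomputable def xVar {k m : ℕ} (j : Fin k) : RatFun k m :=
  algebraMap (MvPolynomial (Fin k ⊕ Fin m) ℚ) (RatFun k m) (MvPolynomial.X (Sum.inl j))

/-- The variable `y_{b+1}`. -/
noncomputable def yVar {k m : ℕ} (b : Fin m) : RatFun k m :=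
  algebraMap (MvPolynomial (Fin k ⊕ Fin m) ℚ) (RatFun k m) (MvPolynomial.X (Sum.inr b))

/-- The first `k` columns of the matrix `Z`: the entry in row `i + 1` and column `j + 1` is
`∏_{1 ≤ b < i+1} (x_{j+1} + y_b) / ∏_{1 ≤ a < j+1} (x_{j+1} - x_a)`. Only rows up to `m + 1` are
meaningful, and only those are used. -/
noncomputable def zEntry {k m : ℕ} (i : ℕ) (j : Fin k) : RatFun k m :=
  (∏ b : Fin m with b.val < i, (xVar j + yVar b)) / ∏ a : Fin k with a < j, (xVar j - xVar a)

/-- The elements of `I(λ) = {λ_k + 1, λ_{k-1} + 2, …, λ_1 + k}` in increasing order, shifted by `1`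
because rows are numbered from `0` in the code. -/
def schurRow {k : ℕ} (lam : Fin k → ℕ) (r : Fin k) : ℕ := lam r.rev + r.val

theorem schurRow_strictMono {k : ℕ} {lam : Fin k → ℕ} (h : Antitone lam) :
    StrictMono (schurRow lam) := by
  intro a b hab
  have h1 : lam a.rev ≤ lam b.rev := h (Fin.rev_le_rev.mpr hab.le)
  have h2 : a.val < b.val := hab
  unfold schurRow
  omega

/-- The double Schur polynomial `s_λ(x_1, …, x_k | y)`: the flag minor of `Z` in the rows `I(λ)` and
the columns `1, …, k`. (Take `m = k + λ_1 - 1`, the number of the `y` variables that occur.) -/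
noncomputable def doubleSchur {k : ℕ} (m : ℕ) (lam : Fin k → ℕ) : RatFun k m :=
  Matrix.det (Matrix.of fun r j : Fin k => zEntry (schurRow lam r) j)

/-! ## Subtraction-free arithmetic circuits -/

/-- A node of a subtraction-free circuit: an input variable `x` or `y`, a scalar input, or an
addition, multiplication or division. In a circuit `α = ℕ`, and the operands of an arithmetic gate
are positions of nodes. (With expressions for `α` this is the template of a node in a program.) -/
inductive Gate (α : Type) : Type
  | x (i : α)
  | y (i : α)
  | scalar (c : α)
  | add (a b : α)
  | mul (a b : α)
  | div (a b : α)

namespace Gate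

/-- The data carried by a node. -/
def operands {α : Type} : Gate α → List α
  | x i => [i]
  | y i => [i]
  | scalar c => [c]
  | add a b => [a, b]
  | mul a b => [a, b]
  | div a b => [a, b]

def map {α β : Type} (f : α → β) : Gate α → Gate β
  | x i => x (f i)
  | y i => y (f i)
  | scalar c => scalar (f c)
  | add a b => add (f a) (f b)
  | mul a b => mul (f a) (f b)
  | div a b => div (f a) (f b)

/-- The node at position `t` of a circuit is legitimate and is correctly evaluated by `v`, where
`v s` is the value at position `s`. Variables are taken from `x_1, …, x_k, y_1, …, y_m`, scalars are
positive integers, operands are earlier nodes, and one never divides by the zero function. -/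
def Holds {k m : ℕ} (v : ℕ → RatFun k m) (t : ℕ) : Gate ℕ → Prop
  | x i => ∃ h : i < k, v t = xVar ⟨i, h⟩
  | y i => ∃ h : i < m, v t = yVar ⟨i, h⟩
  | scalar c => 0 < c ∧ v t = (c : RatFun k m)
  | add a b => a < t ∧ b < t ∧ v t = v a + v b
  | mul a b => a < t ∧ b < t ∧ v t = v a * v b
  | div a b => a < t ∧ b < t ∧ v b ≠ 0 ∧ v t = v a / v b

end Gate

/-- A subtraction-free circuit as the list of its nodes, the last one being the output. Its length,
which counts the inputs as well as the arithmetic gates, is its size. -/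
abbrev Circuit : Type := List (Gate ℕ)

/-- The circuit `c` is well formed, has inputs among `x_1, …, x_k, y_1, …, y_m` and positive
integers, and computes the rational function `f`. -/
def Circuit.Computes {k m : ℕ} (c : Circuit) (f : RatFun k m) : Prop :=
  ∃ v : ℕ → RatFun k m,
    (∀ (t : ℕ) (ht : t < c.length), (c.get ⟨t, ht⟩).Holds v t) ∧ c ≠ [] ∧ v (c.length - 1) = f

/-! ## A random access machine with bit costs

The machine has registers and an indirectly addressed memory, both holding natural numbers. It
controls an arithmetic unit: the command `emit` loads an input or performs one operation `+`, `*`,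
`/` on numbers produced earlier (referred to by their serial numbers). The control cannot inspect
those numbers, so a run of the machine is an execution of a circuit, namely of the list of emitted
nodes. Integer operations of the control are charged by the bit lengths of all numbers that take
part in them (multiplication by the product of the bit lengths); an operation of the arithmetic unit
is charged `w ^ 2`, where `w` is the bit length of the numbers it works with. -/

/-- Integer expressions of the control; `sub` is truncated at `0`. -/
inductive Expr : Type
  | lit (c : ℕ)
  | reg (r : ℕ)
  | mem (e : Expr)
  | add (e f : Expr)
  | sub (e f : Expr)
  | mul (e f : Expr)

/-- Programs. Tests succeed on nonzero values. -/
inductive Program : Type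
  | skip
  | set (r : ℕ) (e : Expr)
  | store (addr e : Expr)
  | emit (g : Gate Expr)
  | seq (p q : Program)
  | ite (e : Expr) (p q : Program)
  | loop (e : Expr) (p : Program)

structure State : Type where
  reg : ℕ → ℕ
  mem : ℕ → ℕ
  out : Circuit

namespace Expr

def eval (s : State) : Expr → ℕ
  | lit c => c
  | reg r => s.reg r
  | mem e => s.mem (eval s e)
  | add e f => eval s e + eval s f
  | sub e f => eval s e - eval s f
  | mul e f => eval s e * eval s f

/-- The number of bit operations charged for the evaluation (`Nat.size` is the bit length). -/
def cost (s : State) : Expr → ℕ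
  | lit c => c.size + 1
  | reg r => (s.reg r).size + 1
  | mem e => cost s e + (eval s e).size + (s.mem (eval s e)).size + 1
  | add e f => cost s e + cost s f + (eval s e).size + (eval s f).size + 1
  | sub e f => cost s e + cost s f + (eval s e).size + (eval s f).size + 1
  | mul e f => cost s e + cost s f + ((eval s e).size + 1) * ((eval s f).size + 1)

end Expr

/-- `Exec w p s s' t`: with an arithmetic unit working on `w`-bit numbers, the program `p` started
in the state `s` halts in the state `s'`, and the total cost of the run is `t` bit operations. -/
inductive Exec (w : ℕ) : Program → State → State → ℕ → Prop
  | skip (s : State) : Exec w .skip s s 1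
  | set (s : State) (r : ℕ) (e : Expr) :
      Exec w (.set r e) s { s with reg := Function.update s.reg r (e.eval s) }
        (e.cost s + (e.eval s).size + 1)
  | store (s : State) (addr e : Expr) :
      Exec w (.store addr e) s { s with mem := Function.update s.mem (addr.eval s) (e.eval s) }
        (addr.cost s + e.cost s + (addr.eval s).size + (e.eval s).size + 1)
  | emit (s : State) (g : Gate Expr) :
      Exec w (.emit g) s { s with out := s.out ++ [g.map (Expr.eval s)] }
        ((g.operands.map (Expr.cost s)).sum + s.out.length.size + w ^ 2 + 1)
  | seq {p q : Program} {s₁ s₂ s₃ : State} {t₁ t₂ : ℕ} :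
      Exec w p s₁ s₂ t₁ → Exec w q s₂ s₃ t₂ → Exec w (.seq p q) s₁ s₃ (t₁ + t₂)
  | ite_true {e : Expr} {p q : Program} {s s' : State} {t : ℕ} :
      e.eval s ≠ 0 → Exec w p s s' t → Exec w (.ite e p q) s s' (e.cost s + t + 1)
  | ite_false {e : Expr} {p q : Program} {s s' : State} {t : ℕ} :
      e.eval s = 0 → Exec w q s s' t → Exec w (.ite e p q) s s' (e.cost s + t + 1)
  | loop_true {e : Expr} {p : Program} {s₁ s₂ s₃ : State} {t₁ t₂ : ℕ} :
      e.eval s₁ ≠ 0 → Exec w p s₁ s₂ t₁ → Exec w (.loop e p) s₂ s₃ t₂ →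
        Exec w (.loop e p) s₁ s₃ (e.cost s₁ + t₁ + t₂ + 1)
  | loop_false {e : Expr} {p : Program} {s : State} :
      e.eval s = 0 → Exec w (.loop e p) s s (e.cost s + 1)

/-- The start on the input `λ = (λ_1, …, λ_k)`: register `0` holds `k`, memory cells `0, …, k - 1`
hold `λ_1, …, λ_k`, everything else is zero, and no arithmetic has been performed. -/
def initState {k : ℕ} (lam : Fin k → ℕ) : State where
  reg := fun r => if r = 0 then k else 0
  mem := fun a => if h : a < k then lam ⟨a, h⟩ else 0
  out := []

end DoubleSchur

/-!
Let `μ_0 ≤ … ≤ μ_{k-1}` be the parts of `λ` in increasing order, and let the window minor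
`W(s, a, l)` be the flag minor of `Z` in the rows `i + min s μ_i`, `a ≤ i < a + l`, counted from
`0`. At `s = 0` these rows form an interval, and the minor is a product of factors `x_j + y_b`. As
`s` grows by one, every row that has not reached its final place moves up by one, and at `s = λ_1`
the rows are `I(λ)`. The three-term exchange relation between flag minors, a consequence of the
Desnanot–Jacobi identity, turns each `W(s + 1, a, l)` into a sum of two products of other window
minors, divided by a window minor. No divisor vanishes, because every window minor is a quotient of
polynomials that are positive at `(1, …, 1)`.

There are `O(n³)` triples `(s, a, l)`, each served by a bounded number of nodes, and a program that
lists them in lexicographic order only handles numbers of `O(log n)` bits.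
-/

namespace DoubleSchur

open Finset Matrix

/-! ## Determinantal identities -/

section Determinants

variable {n R : Type*} [Fintype n] [DecidableEq n] [CommRing R]

theorem det_one_updateCol_updateCol {a b : n} (hab : a ≠ b) (u v : n → R) :
    (((1 : Matrix n n R).updateCol a u).updateCol b v).det = u a * v b - v a * u b := by
  let U : Matrix n (Fin 2) R := of fun i => ![u i - (1 : Matrix n n R) i a,
    v i - (1 : Matrix n n R) i b]
  let V : Matrix (Fin 2) n R := of ![Pi.single a 1, Pi.single b 1]
  have hUV : ((1 : Matrix n n R).updateCol a u).updateCol b v = 1 + U * V := by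
    ext i j
    rw [Matrix.add_apply, mul_apply, Fin.sum_univ_two, updateCol_apply, updateCol_apply]
    by_cases hb : j = b
    · simp [U, V, hb, hab.symm, one_apply]
    · by_cases ha : j = a <;> simp [U, V, hb, ha, hab, one_apply]
  have hVU : 1 + V * U = !![u a, v a; u b, v b] := by
    ext i j
    fin_cases i <;> fin_cases j <;> simp [U, V, hab, hab.symm]
  rw [hUV, det_one_add_mul_comm, hVU, det_fin_two_of]

/-- This is Jacobi's identity for the minors of order `2` of the adjugate, before the cancellation
of `det M`. -/
theorem det_mul_det_mul_det_updateCol_updateCol (M : Matrix n n R) {a b : n} (hab : a ≠ b)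
    (c d : n) :
    M.det * (M.det * ((M.updateCol a (Pi.single c 1)).updateCol b (Pi.single d 1)).det) =
      M.det * (M.adjugate a c * M.adjugate b d - M.adjugate a d * M.adjugate b c) := by
  have hcol (e : n) : M *ᵥ M.adjugate.col e = M.det • Pi.single e 1 := by
    ext i
    have := congrFun (congrFun (mul_adjugate M) i) e
    simpa [Pi.single_apply, one_apply, mul_apply, mulVec, dotProduct] using this
  have hprod : M * ((1 : Matrix n n R).updateCol a (M.adjugate.col c)).updateCol b
      (M.adjugate.col d) =
      (M.updateCol a (M.det • Pi.single c 1)).updateCol b (M.det • Pi.single d 1) := by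
    rw [mul_updateCol, mul_updateCol, mul_one, hcol, hcol]
  have hdet := congrArg det hprod
  rw [det_mul, det_one_updateCol_updateCol hab, det_updateCol_smul, updateCol_comm _ hab,
    det_updateCol_smul, updateCol_comm _ hab.symm] at hdet
  exact hdet.symm

/-- The factor `det M` is cancelled over the domain `ℤ[X]`, where `X` is the generic matrix. -/
theorem det_mul_det_updateCol_updateCol (M : Matrix n n R) {a b : n} (hab : a ≠ b) (c d : n) :
    M.det * ((M.updateCol a (Pi.single c 1)).updateCol b (Pi.single d 1)).det =
      M.adjugate a c * M.adjugate b d - M.adjugate a d * M.adjugate b c := by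
  let φ := MvPolynomial.eval₂Hom (Int.castRingHom R) fun p : n × n => M p.1 p.2
  have hφ : φ.mapMatrix (mvPolynomialX n n ℤ) = M := mvPolynomialX_map_eval₂ _ M
  have hgeneric := congrArg φ <| mul_left_cancel₀ (det_mvPolynomialX_ne_zero n ℤ) <|
    det_mul_det_mul_det_updateCol_updateCol (mvPolynomialX n n ℤ) hab c d
  have hadj (i j : n) : φ ((mvPolynomialX n n ℤ).adjugate i j) = M.adjugate i j := by
    rw [← hφ, ← RingHom.map_adjugate]
    rfl
  have hsingle (e : n) : φ ∘ (Pi.single e 1 : n → _) = Pi.single e 1 := by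
    ext i
    simp [Pi.single_apply, apply_ite φ]
  simpa only [map_sub, map_mul, hadj, RingHom.map_det, RingHom.mapMatrix_apply, map_updateCol,
    hsingle, show (mvPolynomialX n n ℤ).map φ = M from hφ] using hgeneric

theorem det_updateCol_single_one (M : Matrix n n R) (i j : n) :
    (M.updateCol i (Pi.single j 1)).det = M.adjugate i j := by
  rw [← cramer_apply, cramer_eq_adjugate_mulVec, mulVec_single_one, col_apply]

/-- The Desnanot–Jacobi identity, on which Dodgson condensation is based. -/
theorem det_mul_det_submatrix_interior {m : ℕ} (M : Matrix (Fin (m + 2)) (Fin (m + 2)) R) :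
    M.det * (M.submatrix (fun i : Fin m => i.succ.castSucc) fun i => i.succ.castSucc).det =
      (M.submatrix Fin.succ Fin.succ).det * (M.submatrix Fin.castSucc Fin.castSucc).det -
      (M.submatrix Fin.succ Fin.castSucc).det * (M.submatrix Fin.castSucc Fin.succ).det := by
  have hcorner : (M.updateCol 0 (Pi.single 0 1)).submatrix Fin.castSucc Fin.castSucc =
      (M.submatrix Fin.castSucc Fin.castSucc).updateCol 0 (Pi.single 0 1) := by
    ext i j
    simp [updateCol_apply, Pi.single_apply]
  have hinterior : ((M.updateCol 0 (Pi.single 0 1)).updateCol (Fin.last _)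
      (Pi.single (Fin.last _) 1)).det =
      (M.submatrix (fun i : Fin m => i.succ.castSucc) fun i => i.succ.castSucc).det := by
    rw [det_updateCol_single_one, adjugate_fin_succ_eq_det_submatrix, Fin.succAbove_last,
      hcorner, det_updateCol_single_one, adjugate_fin_succ_eq_det_submatrix, Fin.succAbove_zero,
      submatrix_submatrix]
    simp [← two_mul, Function.comp_def]
  have h := det_mul_det_updateCol_updateCol M (Fin.last_pos' (n := m + 1)).ne 0 (Fin.last _)
  have hsign : (-1 : R) ^ (m + 1) * (-1) ^ (m + 1) = 1 := by simp [← pow_add, ← two_mul]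
  rw [hinterior] at h
  simp only [adjugate_fin_succ_eq_det_submatrix, Fin.succAbove_zero, Fin.succAbove_last,
    Fin.val_zero, Fin.val_last, add_zero, zero_add, pow_zero, one_mul, pow_add] at h
  linear_combination h + ((M.submatrix Fin.succ Fin.succ).det *
    (M.submatrix Fin.castSucc Fin.castSucc).det - (M.submatrix Fin.succ Fin.castSucc).det *
    (M.submatrix Fin.castSucc Fin.succ).det) * hsign

end Determinants

section FlagMinors

variable {R : Type*} [CommRing R]

/-- The flag minor of an infinite matrix: the determinant of its first `l` rows and columns. Other
sets of rows are selected by composing `F` with an enumeration of them. -/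
def flagMinor (F : ℕ → ℕ → R) (l : ℕ) : R := (of fun i j : Fin l => F i j).det

theorem flagMinor_congr {F G : ℕ → ℕ → R} {l : ℕ} (h : ∀ i < l, ∀ j < l, F i j = G i j) :
    flagMinor F l = flagMinor G l := by
  unfold flagMinor
  congr 1
  ext i j
  exact h i i.isLt j j.isLt

/-- The increasing enumeration of the natural numbers other than `p`. -/
def skipAt (p i : ℕ) : ℕ := if i < p then i else i + 1

theorem skipAt_succ_succ (p i : ℕ) : skipAt (p + 1) (i + 1) = skipAt p i + 1 := by
  unfold skipAt
  split_ifs <;> omega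

/-- The matrix `F` with an additional first column, which is the unit vector at `p`. -/
def markRow (p : ℕ) (F : ℕ → ℕ → R) (i : ℕ) : ℕ → R
  | 0 => if i = p then 1 else 0
  | j + 1 => F i j

theorem markRow_succ (p : ℕ) (F : ℕ → ℕ → R) :
    (fun i => markRow (p + 1) F (i + 1)) = markRow p fun i => F (i + 1) := by
  funext i j
  cases j <;> simp [markRow]

theorem flagMinor_markRow (F : ℕ → ℕ → R) {p l : ℕ} (hp : p ≤ l) :
    flagMinor (markRow p F) (l + 1) = (-1) ^ p * flagMinor (fun i => F (skipAt p i)) l := by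
  unfold flagMinor
  rw [det_succ_column_zero, sum_eq_single ⟨p, by omega⟩]
  · simp only [of_apply, Fin.val_zero, markRow, if_true, mul_one]
    congr 2
    ext i j
    simp only [submatrix_apply, of_apply, Fin.val_succ, Fin.succAbove, skipAt, Fin.lt_def,
      Fin.val_castSucc]
    split <;> simp
  · intro i _ hi
    have : (i : ℕ) ≠ p := fun h => hi (Fin.ext h)
    simp [markRow, this]
  · simp

theorem flagMinor_mul_flagMinor_interior (F : ℕ → ℕ → R) (m : ℕ) :
    flagMinor F (m + 2) * flagMinor (fun i j => F (i + 1) (j + 1)) m =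
      flagMinor (fun i j => F (i + 1) (j + 1)) (m + 1) * flagMinor F (m + 1) -
      flagMinor (fun i => F (i + 1)) (m + 1) * flagMinor (fun i j => F i (j + 1)) (m + 1) :=
  det_mul_det_submatrix_interior (of fun i j : Fin (m + 2) => F i j)

/-- The three-term Plücker relation between flag minors in which the rows `0`, `p + 1` and `m + 2`
are exchanged. -/
theorem flagMinor_exchange (F : ℕ → ℕ → R) {p m : ℕ} (hpm : p ≤ m) :
    flagMinor (fun i => F (skipAt (p + 1) i)) (m + 2) * flagMinor (fun i => F (i + 1)) (m + 1) =
      flagMinor F (m + 2) * flagMinor (fun i => F (skipAt (p + 1) (i + 1))) (m + 1) +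
      flagMinor (fun i => F (i + 1)) (m + 2) *
        flagMinor (fun i => F (skipAt (p + 1) i)) (m + 1) := by
  have h := flagMinor_mul_flagMinor_interior (markRow (p + 1) F) (m + 1)
  rw [markRow_succ, flagMinor_markRow F (by omega), flagMinor_markRow F (by omega),
    flagMinor_markRow _ (by omega)] at h
  simp only [markRow, pow_succ] at h
  simp only [skipAt_succ_succ]
  have hsign : (-1 : R) ^ p * (-1) ^ p = 1 := by simp [← pow_add, ← two_mul]
  linear_combination (-(-1) ^ p) * h + (flagMinor (fun i => F (i + 1)) (m + 2) *
    flagMinor (fun i => F (skipAt (p + 1) i)) (m + 1) + flagMinor F (m + 2) *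
    flagMinor (fun i => F (skipAt p i + 1)) (m + 1) - flagMinor (fun i => F (skipAt (p + 1) i))
    (m + 2) * flagMinor (fun i => F (i + 1)) (m + 1)) * hsign

end FlagMinors

/-! ## Flag minors of the matrix `Z` -/

section ZMatrix

variable {K : Type*} [Field K]

/-- The matrix `Z` for arbitrary sequences `x` and `y` in a field. -/
def zMatrix (x y : ℕ → K) (i j : ℕ) : K :=
  (∏ b ∈ range i, (x j + y b)) / ∏ a ∈ range j, (x j - x a)

theorem det_vandermonde_eq_prod_range {A : Type*} [CommRing A] (x : ℕ → A) (l : ℕ) :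
    (vandermonde fun j : Fin l => x j).det = ∏ j : Fin l, ∏ a ∈ range j, (x j - x a) := by
  rw [det_vandermonde, prod_comm' (t' := univ) (s' := fun j => Iio j) (by simp)]
  refine prod_congr rfl fun j _ => ?_
  rw [← Nat.Iio_eq_range, ← Fin.map_valEmbedding_Iio, prod_map]
  rfl

/-- The factors `y_b` with `b < c` are common to a column; the rest is a Vandermonde determinant. -/
theorem flagMinor_zMatrix (x y : ℕ → K) (c : ℕ) {l : ℕ} (hx : Set.InjOn x (Set.Iio l)) :
    flagMinor (fun i => zMatrix x y (c + i)) l = ∏ j ∈ range l, ∏ b ∈ range c, (x j + y b) := by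
  let p (i : Fin l) : Polynomial K :=
    ∏ b ∈ range (i : ℕ), (Polynomial.X + Polynomial.C (y (c + b)))
  have hmonic (i) : (p i).Monic :=
    Polynomial.monic_prod_of_monic _ _ fun b _ => Polynomial.monic_X_add_C _
  have hdegree (i) : (p i).natDegree = i := by
    rw [Polynomial.natDegree_prod_of_monic _ _ fun b _ => Polynomial.monic_X_add_C _]
    simp
  have hdet : (of fun i j : Fin l => (p i).eval (x j)).det =
      ∏ j : Fin l, ∏ a ∈ range j, (x j - x a) := by
    rw [← det_vandermonde_eq_prod_range, ← det_transpose,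
      det_eval_matrixOfPolynomials_eq_det_vandermonde (fun j : Fin l => x j) p hdegree hmonic]
    rfl
  have hdenom (j : Fin l) : ∏ a ∈ range (j : ℕ), (x j - x a) ≠ 0 := by
    refine prod_ne_zero_iff.mpr fun a ha => sub_ne_zero.mpr fun h => ?_
    have haj : a < j := mem_range.mp ha
    exact haj.ne' (hx j.isLt (haj.trans j.isLt) h)
  have hentry : (of fun i j : Fin l => zMatrix x y (c + i) j) = of fun i j : Fin l =>
      ((∏ b ∈ range c, (x j + y b)) / ∏ a ∈ range (j : ℕ), (x j - x a)) * (p i).eval (x j) := by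
    ext i j
    simp only [of_apply, p, zMatrix, prod_range_add, Polynomial.eval_prod, Polynomial.eval_add,
      Polynomial.eval_X, Polynomial.eval_C]
    ring
  rw [flagMinor, hentry]
  refine (det_mul_row _ (of fun i j : Fin l => (p i).eval (x j))).trans ?_
  rw [hdet, ← prod_mul_distrib, ← Fin.prod_univ_eq_prod_range
    (fun j => ∏ b ∈ range c, (x j + y b))]
  exact prod_congr rfl fun j _ => div_mul_cancel₀ _ (hdenom j)

/-- The rows `i + min s (μ i)` move, as `s` grows, from an initial interval to the rows
`i + μ i`. -/
def rowSeq (μ : ℕ → ℕ) (s i : ℕ) : ℕ := i + min s (μ i)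

/-- The flag minor of `Z` in the rows `rowSeq μ s a, …, rowSeq μ s (a + l - 1)`. -/
def windowMinor (x y : ℕ → K) (μ : ℕ → ℕ) (s a l : ℕ) : K :=
  flagMinor (fun i => zMatrix x y (rowSeq μ s (a + i))) l

variable (x y : ℕ → K) {μ : ℕ → ℕ} {s a l : ℕ}

theorem windowMinor_size_zero (μ : ℕ → ℕ) (s a : ℕ) : windowMinor x y μ s a 0 = 1 := by
  simp [windowMinor, flagMinor]

theorem windowMinor_zero (μ : ℕ → ℕ) (a : ℕ) (hx : Set.InjOn x (Set.Iio l)) :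
    windowMinor x y μ 0 a l = ∏ j ∈ range l, ∏ b ∈ range a, (x j + y b) := by
  rw [← flagMinor_zMatrix x y a hx]
  simp [windowMinor, rowSeq]

theorem windowMinor_zero_succ_succ (μ : ℕ → ℕ) (a : ℕ) (hx : Set.InjOn x (Set.Iio (l + 1))) :
    windowMinor x y μ 0 (a + 1) (l + 1) * windowMinor x y μ 0 a l =
      windowMinor x y μ 0 a (l + 1) * windowMinor x y μ 0 (a + 1) l * (x l + y a) := by
  have hx' : Set.InjOn x (Set.Iio l) := hx.mono (Set.Iio_subset_Iio l.le_succ)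
  simp only [windowMinor_zero x y μ _ hx, windowMinor_zero x y μ _ hx', prod_range_succ]
  ring

theorem windowMinor_succ_of_lt (hμ : Monotone μ) (h : s < μ a) (l : ℕ) :
    windowMinor x y μ (s + 1) a l = windowMinor x y μ s (a + 1) l := by
  refine flagMinor_congr fun i _ j _ => ?_
  have h1 : μ a ≤ μ (a + i) := hμ (by omega)
  have h2 : μ a ≤ μ (a + 1 + i) := hμ (by omega)
  rw [show rowSeq μ (s + 1) (a + i) = rowSeq μ s (a + 1 + i) by unfold rowSeq; omega]

theorem windowMinor_succ_of_le (hμ : Monotone μ) (h : μ (a + l - 1) ≤ s) :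
    windowMinor x y μ (s + 1) a l = windowMinor x y μ s a l := by
  refine flagMinor_congr fun i hi j _ => ?_
  have h1 : μ (a + i) ≤ μ (a + l - 1) := hμ (by omega)
  rw [show rowSeq μ (s + 1) (a + i) = rowSeq μ s (a + i) by unfold rowSeq; omega]

/-- The first row `a + i` of the window that moves is omitted by the rows at `s + 1`. -/
theorem exists_rowSeq_succ_eq_skipAt (hμ : Monotone μ) (h1 : μ a ≤ s) (h2 : s < μ (a + l)) :
    ∃ p < l, ∀ i, rowSeq μ (s + 1) (a + i) = rowSeq μ s (a + skipAt (p + 1) i) := by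
  have hmoves : ∃ i, s < μ (a + i) := ⟨l, h2⟩
  obtain ⟨p, hp⟩ : ∃ p, Nat.find hmoves = p + 1 :=
    Nat.exists_eq_add_one.mpr <| (Nat.find_pos hmoves).mpr (by simpa using h1)
  have hpl : p + 1 ≤ l := hp ▸ Nat.find_min' hmoves h2
  have hmove : s < μ (a + (p + 1)) := hp ▸ Nat.find_spec hmoves
  refine ⟨p, hpl, fun i => ?_⟩
  unfold rowSeq skipAt
  split_ifs with hi
  · have : ¬ s < μ (a + i) := Nat.find_min hmoves (hp ▸ hi)
    omega
  · have h3 : μ (a + (p + 1)) ≤ μ (a + i) := hμ (by omega)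
    have h4 : μ (a + i) ≤ μ (a + (i + 1)) := hμ (by omega)
    omega

theorem windowMinor_exchange (hμ : Monotone μ) (h1 : μ a ≤ s) (h2 : s < μ (a + l)) :
    windowMinor x y μ (s + 1) a (l + 1) * windowMinor x y μ s (a + 1) l =
      windowMinor x y μ s a (l + 1) * windowMinor x y μ (s + 1) (a + 1) l +
      windowMinor x y μ s (a + 1) (l + 1) * windowMinor x y μ (s + 1) a l := by
  obtain ⟨p, hpl, hrow⟩ := exists_rowSeq_succ_eq_skipAt hμ h1 h2
  obtain ⟨m, rfl⟩ : ∃ m, l = m + 1 := Nat.exists_eq_add_one.mpr (by omega)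
  have h := flagMinor_exchange (fun i => zMatrix x y (rowSeq μ s (a + i))) (Nat.le_of_lt_succ hpl)
  simp only [← hrow] at h
  simpa only [windowMinor, add_assoc, add_comm 1] using h

end ZMatrix

/-! ## Positivity -/

section Positivity

variable {A F K : Type*} [CommRing A] [CommSemiring F] [PartialOrder F] [Field K] [Algebra A K]
  {φ : A →+* F} {f g : K}

/-- The element `f` of the fraction field `K` of `A` is a quotient of elements that are positive
under `φ`. Subtraction-free expressions have this property, and it implies `f ≠ 0`. -/
def IsPosQuotient (φ : A →+* F) (f : K) : Prop :=
  ∃ p q : A, 0 < φ p ∧ 0 < φ q ∧ f = algebraMap A K p / algebraMap A K q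

namespace IsPosQuotient

theorem algebraMap_ne_zero [IsFractionRing A K] {p : A} (hp : 0 < φ p) : algebraMap A K p ≠ 0 := by
  refine fun h => hp.ne' ?_
  rw [(injective_iff_map_eq_zero _).mp (IsFractionRing.injective A K) p h, map_zero]

theorem ne_zero [IsFractionRing A K] (hf : IsPosQuotient φ f) : f ≠ 0 := by
  obtain ⟨p, q, hp, hq, rfl⟩ := hf
  exact div_ne_zero (algebraMap_ne_zero hp) (algebraMap_ne_zero hq)

theorem inv (hf : IsPosQuotient φ f) : IsPosQuotient φ f⁻¹ := by
  obtain ⟨p, q, hp, hq, rfl⟩ := hf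
  exact ⟨q, p, hq, hp, inv_div _ _⟩

variable [IsStrictOrderedRing F]

theorem of_pos {p : A} (hp : 0 < φ p) : IsPosQuotient φ (algebraMap A K p) :=
  ⟨p, 1, hp, by simp, by simp⟩

theorem one (φ : A →+* F) : IsPosQuotient φ (1 : K) :=
  map_one (algebraMap A K) ▸ of_pos (by simp)

theorem mul (hf : IsPosQuotient φ f) (hg : IsPosQuotient φ g) : IsPosQuotient φ (f * g) := by
  obtain ⟨p, q, hp, hq, rfl⟩ := hf
  obtain ⟨p', q', hp', hq', rfl⟩ := hg
  exact ⟨p * p', q * q', map_mul φ p p' ▸ mul_pos hp hp', map_mul φ q q' ▸ mul_pos hq hq',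
    by simp only [map_mul, div_mul_div_comm]⟩

theorem div (hf : IsPosQuotient φ f) (hg : IsPosQuotient φ g) : IsPosQuotient φ (f / g) :=
  div_eq_mul_inv f g ▸ hf.mul hg.inv

theorem prod {ι : Type*} (s : Finset ι) {f : ι → K} (hf : ∀ i ∈ s, IsPosQuotient φ (f i)) :
    IsPosQuotient φ (∏ i ∈ s, f i) :=
  prod_induction f _ (fun _ _ => mul) (one φ) hf

variable [IsFractionRing A K]

theorem add (hf : IsPosQuotient φ f) (hg : IsPosQuotient φ g) : IsPosQuotient φ (f + g) := by
  obtain ⟨p, q, hp, hq, rfl⟩ := hf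
  obtain ⟨p', q', hp', hq', rfl⟩ := hg
  refine ⟨p * q' + q * p', q * q', ?_, map_mul φ q q' ▸ mul_pos hq hq', ?_⟩
  · simpa only [map_add, map_mul] using add_pos (mul_pos hp hq') (mul_pos hq hp')
  · rw [div_add_div _ _ (algebraMap_ne_zero hq) (algebraMap_ne_zero hq')]
    simp only [map_add, map_mul]

theorem windowMinor {x y : ℕ → K} (hx : ∀ j, IsPosQuotient φ (x j))
    (hy : ∀ b, IsPosQuotient φ (y b)) {μ : ℕ → ℕ} (hμ : Monotone μ) {k : ℕ}
    (hinj : Set.InjOn x (Set.Iio k)) (s : ℕ) :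
    ∀ a l : ℕ, l ≤ k → IsPosQuotient φ (windowMinor x y μ s a l) := by
  induction s with
  | zero =>
    intro a l hl
    rw [windowMinor_zero x y μ a (hinj.mono (Set.Iio_subset_Iio hl))]
    exact .prod _ fun j _ => .prod _ fun b _ => (hx j).add (hy b)
  | succ s ih =>
    intro a l
    induction l generalizing a with
    | zero => exact fun _ => windowMinor_size_zero x y μ _ _ ▸ one φ
    | succ l ihl =>
      intro hl
      by_cases h1 : s < μ a
      · exact windowMinor_succ_of_lt x y hμ h1 _ ▸ ih _ _ hl
      by_cases h2 : μ (a + l) ≤ s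
      · exact windowMinor_succ_of_le (l := l + 1) x y hμ h2 ▸ ih _ _ hl
      · have hdivisor := ih (a + 1) l (by omega)
        rw [eq_div_of_mul_eq hdivisor.ne_zero
          (windowMinor_exchange x y hμ (not_lt.mp h1) (not_le.mp h2))]
        exact (((ih _ _ hl).mul (ihl _ (by omega))).add
          ((ih _ _ hl).mul (ihl _ (by omega)))).div hdivisor

end IsPosQuotient

end Positivity

/-! ## The double Schur polynomial as the last window minor -/

section DoubleSchurPolynomial

variable {k m : ℕ}

/-- The variables `x`, continued by `1`. -/
noncomputable def xSeq (k m j : ℕ) : RatFun k m := if h : j < k then xVar ⟨j, h⟩ else 1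

/-- The variables `y`, continued by `1`. -/
noncomputable def ySeq (k m b : ℕ) : RatFun k m := if h : b < m then yVar ⟨b, h⟩ else 1

/-- The evaluation of polynomials at `x = y = (1, 1, …)`, by which positivity is tested. -/
noncomputable abbrev evalOne (k m : ℕ) : MvPolynomial (Fin k ⊕ Fin m) ℚ →+* ℚ :=
  MvPolynomial.eval fun _ => 1

theorem isPosQuotient_xSeq (j : ℕ) : IsPosQuotient (evalOne k m) (xSeq k m j) := by
  unfold xSeq
  split
  · exact .of_pos (by simp)
  · exact .one _

theorem isPosQuotient_ySeq (b : ℕ) : IsPosQuotient (evalOne k m) (ySeq k m b) := by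
  unfold ySeq
  split
  · exact .of_pos (by simp)
  · exact .one _

theorem xVar_injective : Function.Injective (xVar : Fin k → RatFun k m) := fun _ _ h =>
  Sum.inl_injective (MvPolynomial.X_injective (IsFractionRing.injective _ (RatFun k m) h))

theorem xSeq_injOn : Set.InjOn (xSeq k m) (Set.Iio k) := by
  intro i (hi : i < k) j (hj : j < k) h
  rw [xSeq, xSeq, dif_pos hi, dif_pos hj] at h
  exact congrArg Fin.val (xVar_injective h)

theorem windowMinor_xSeq_ySeq_ne_zero {μ : ℕ → ℕ} (hμ : Monotone μ) (s a : ℕ) {l : ℕ}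
    (hl : l ≤ k) : windowMinor (xSeq k m) (ySeq k m) μ s a l ≠ 0 :=
  (IsPosQuotient.windowMinor isPosQuotient_xSeq isPosQuotient_ySeq hμ xSeq_injOn s a l hl).ne_zero

theorem zEntry_eq_zMatrix {i : ℕ} (hi : i ≤ m) (j : Fin k) :
    zEntry i j = zMatrix (xSeq k m) (ySeq k m) i j := by
  have hx (a : Fin k) : xVar a = xSeq k m a := by simp [xSeq]
  have hy (b : Fin m) : yVar b = ySeq k m b := by simp [ySeq]
  have hrows : (univ.filter fun b : Fin m => b.val < i).map Fin.valEmbedding = range i := by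
    ext b
    simpa [Fin.exists_iff] using fun h : b < i => h.trans_le hi
  have hcols : (univ.filter fun a : Fin k => a < j).map Fin.valEmbedding = range j := by
    rw [filter_gt_eq_Iio, Fin.map_valEmbedding_Iio, Nat.Iio_eq_range]
  unfold zEntry zMatrix
  simp only [← hrows, ← hcols, prod_map, Fin.valEmbedding_apply, hx, hy]

/-- The parts of `λ` in increasing order, continued by `λ_1`. -/
def reversedPart (lam : Fin k → ℕ) (i : ℕ) : ℕ := (initState lam).mem (k - 1 - i)

theorem reversedPart_eq (hk : 0 < k) (lam : Fin k → ℕ) (i : ℕ) :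
    reversedPart lam i = lam ⟨k - 1 - i, by omega⟩ :=
  dif_pos (by omega)

theorem reversedPart_monotone {lam : Fin k → ℕ} (hk : 0 < k) (h : Antitone lam) :
    Monotone (reversedPart lam) := by
  intro i j hij
  rw [reversedPart_eq hk, reversedPart_eq hk]
  exact h (Nat.sub_le_sub_left hij _)

theorem doubleSchur_eq_windowMinor (hk : 0 < k) {lam : Fin k → ℕ} (h : Antitone lam) :
    doubleSchur (k + lam ⟨0, hk⟩ - 1) lam =
      windowMinor (xSeq k _) (ySeq k _) (reversedPart lam) (lam ⟨0, hk⟩) 0 k := by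
  unfold doubleSchur windowMinor flagMinor
  congr 1
  ext r j
  have hpart : reversedPart lam r = lam r.rev := by
    rw [reversedPart_eq hk]
    congr 2
    omega
  have hle : lam r.rev ≤ lam ⟨0, hk⟩ := h (Nat.zero_le _)
  have hrow : rowSeq (reversedPart lam) (lam ⟨0, hk⟩) (0 + r) = schurRow lam r := by
    rw [rowSeq, zero_add, hpart, min_eq_right hle, schurRow, add_comm]
  simp only [of_apply, hrow]
  refine zEntry_eq_zMatrix ?_ j
  unfold schurRow
  omega

end DoubleSchurPolynomial

/-! ## The circuit -/

section Gates

/-- The gates of the list `gs`, placed at the positions `p, p + 1, …`, are legitimate and correctly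
evaluated by `v`. -/
def HoldsFrom {k m : ℕ} (v : ℕ → RatFun k m) : ℕ → List (Gate ℕ) → Prop
  | _, [] => True
  | p, g :: gs => g.Holds v p ∧ HoldsFrom v (p + 1) gs

variable {k m : ℕ} {v : ℕ → RatFun k m}

theorem HoldsFrom.append {p : ℕ} {gs hs : List (Gate ℕ)} (hgs : HoldsFrom v p gs)
    (hhs : HoldsFrom v (p + gs.length) hs) : HoldsFrom v p (gs ++ hs) := by
  induction gs generalizing p with
  | nil => exact hhs
  | cons g gs ih =>
    refine ⟨hgs.1, ih hgs.2 ?_⟩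
    rwa [List.length_cons, add_comm gs.length, ← add_assoc] at hhs

theorem HoldsFrom.get {p : ℕ} {gs : List (Gate ℕ)} (h : HoldsFrom v p gs) (t : ℕ)
    (ht : t < gs.length) : (gs.get ⟨t, ht⟩).Holds v (p + t) := by
  induction gs generalizing p t with
  | nil => exact absurd ht (Nat.not_lt_zero t)
  | cons g gs ih =>
    cases t with
    | zero => exact h.1
    | succ t => exact Nat.add_right_comm p t 1 ▸ ih h.2 t (Nat.lt_of_succ_lt_succ ht)

variable {α : Type} [Add α] [Sub α] [Mul α] [∀ c : ℕ, OfNat α c]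

/-- The position of node `j` of the cell `(s, l, q)`. Cells are arranged in lexicographic order,
where `l ≤ k` and `q ≤ n`, and consist of six nodes each.

Here and below `α` is `ℕ` for the circuit and `Expr` for the program that emits it. -/
def node (k n s l q j : α) : α := 6 * ((s * (k + 1) + l) * (n + 1) + q) + j

/-- The gates of a cell with value `1`. -/
def unitGates : List (Gate α) := List.replicate 6 (.scalar 1)

/-- The gates of a cell which repeats the value at `source`, multiplying it by the value `1` at
`start`, the position of the cell's own first node. -/
def copyGates (source start : α) : List (Gate α) := List.replicate 5 (.scalar 1) ++
  [.mul source start]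

/-- The gates of the cell `(0, l, q)`, which implement `windowMinor_zero_succ_succ`. -/
def cornerGates (k n l q : α) : List (Gate α) :=
  [.x (l - 1),
    .y (q - l - 1),
    .add (node k n 0 l q 0) (node k n 0 l q 1),
    .mul (node k n 0 l (q - 1) 5) (node k n 0 (l - 1) (q - 1) 5),
    .mul (node k n 0 l q 3) (node k n 0 l q 2),
    .div (node k n 0 l q 4) (node k n 0 (l - 1) (q - 2) 5)]

/-- The gates of the cell `(s, l, q)` when they implement `windowMinor_exchange`. -/
def exchangeGates (k n s l q : α) : List (Gate α) :=
  [.scalar 1,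
    .scalar 1,
    .mul (node k n (s - 1) l (q - 1) 5) (node k n s (l - 1) q 5),
    .mul (node k n (s - 1) l q 5) (node k n s (l - 1) (q - 1) 5),
    .add (node k n s l q 2) (node k n s l q 3),
    .div (node k n s l q 4) (node k n (s - 1) (l - 1) (q - 1) 5)]

end Gates

section Circuit

/-- The cell `(s, l, q)`. If `s + l ≤ q`, its last node computes the minor of size `l` at the time
`s` whose window starts at `a = q - s - l`; the other cells only fill up the array. Numbering the
windows by `q` instead of `a` makes all operands of a cell precede it coordinatewise. -/
def cell (k n : ℕ) (μ : ℕ → ℕ) (s l q : ℕ) : List (Gate ℕ) :=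
  if q < s + l then unitGates
  else if s = 0 then if 0 < l ∧ l < q then cornerGates k n l q else unitGates
  else if s ≤ μ (q - s - l) then copyGates (node k n (s - 1) l q 5) (node k n s l q 0)
  else if μ (q - s - 1) < s then copyGates (node k n (s - 1) l (q - 1) 5) (node k n s l q 0)
  else exchangeGates k n s l q

/-- The coordinates `(s, l, q)` of the cell with serial number `t`. -/
def coords (k n t : ℕ) : ℕ × ℕ × ℕ := (t / (n + 1) / (k + 1), t / (n + 1) % (k + 1), t % (n + 1))

/-- The first `N` cells. -/
def circuit (k n : ℕ) (μ : ℕ → ℕ) (N : ℕ) : Circuit :=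
  (List.range N).flatMap fun t =>
    cell k n μ (coords k n t).1 (coords k n t).2.1 (coords k n t).2.2

variable {k m n : ℕ} {μ : ℕ → ℕ} {s l q : ℕ}

/-- The minor computed by the cell `(s, l, q)`. -/
noncomputable def cellMinor (k m : ℕ) (μ : ℕ → ℕ) (s l q : ℕ) : RatFun k m :=
  windowMinor (xSeq k m) (ySeq k m) μ s (q - s - l) l

/-- The values at the nodes of the cell `(s, l, q)`. -/
noncomputable def cellValues (k m : ℕ) (μ : ℕ → ℕ) (s l q : ℕ) : List (RatFun k m) :=
  let W := cellMinor k m μ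
  if q < s + l then List.replicate 6 1
  else if s = 0 then
    if 0 < l ∧ l < q then
      let x := xSeq k m (l - 1)
      let y := ySeq k m (q - l - 1)
      let p := W 0 l (q - 1) * W 0 (l - 1) (q - 1)
      [x, y, x + y, p, p * (x + y), W 0 l q]
    else List.replicate 6 1
  else if s ≤ μ (q - s - l) ∨ μ (q - s - 1) < s then [1, 1, 1, 1, 1, W s l q]
  else
    let p := W (s - 1) l (q - 1) * W s (l - 1) q
    let p' := W (s - 1) l q * W s (l - 1) (q - 1)
    [1, 1, p, p', p + p', W s l q]

/-- The values at the nodes of the circuit. -/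
noncomputable def nodeValue (k m n : ℕ) (μ : ℕ → ℕ) (p : ℕ) : RatFun k m :=
  (cellValues k m μ (coords k n (p / 6)).1 (coords k n (p / 6)).2.1
    (coords k n (p / 6)).2.2).getD (p % 6) 0

theorem coords_index (hl : l ≤ k) (hq : q ≤ n) :
    coords k n ((s * (k + 1) + l) * (n + 1) + q) = (s, l, q) := by
  have hq' : q < n + 1 := Nat.lt_succ_of_le hq
  have hl' : l < k + 1 := Nat.lt_succ_of_le hl
  simp [coords, hq', hl', Nat.add_div_of_dvd_right, Nat.div_eq_of_lt, Nat.mod_eq_of_lt,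
    mul_comm _ (k + 1), mul_comm _ (n + 1)]

theorem nodeValue_node (hl : l ≤ k) (hq : q ≤ n) {j : ℕ} (hj : j < 6) :
    nodeValue k m n μ (node k n s l q j) = (cellValues k m μ s l q).getD j 0 := by
  have hdiv : node k n s l q j / 6 = (s * (k + 1) + l) * (n + 1) + q := by
    unfold node
    omega
  have hmod : node k n s l q j % 6 = j := by
    unfold node
    omega
  unfold nodeValue
  rw [hdiv, hmod, coords_index hl hq]

theorem node_lt_node {s' l' q' j j' : ℕ} (hs : s' ≤ s) (hl : l' ≤ l) (hq : q' ≤ q)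
    (hlt : s' + l' + q' < s + l + q) (hj' : j' < 6) :
    node k n s' l' q' j' < node k n s l q j := by
  suffices h : (s' * (k + 1) + l') * (n + 1) + q' < (s * (k + 1) + l) * (n + 1) + q by
    unfold node
    omega
  by_cases h : s' = s ∧ l' = l
  · obtain ⟨rfl, rfl⟩ := h
    omega
  · have hrow : s' * (k + 1) + l' < s * (k + 1) + l := by
      rcases Nat.lt_or_eq_of_le hs with hs | rfl
      · exact Nat.add_lt_add_of_lt_of_le (Nat.mul_lt_mul_of_pos_right hs k.succ_pos) hl
      · omega
    exact Nat.add_lt_add_of_lt_of_le (Nat.mul_lt_mul_of_pos_right hrow n.succ_pos) hq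

theorem cellMinor_zero_of_eq (hl : l ≤ k) (h : l = 0 ∨ l = q) : cellMinor k m μ 0 l q = 1 := by
  rcases h with rfl | rfl
  · exact windowMinor_size_zero _ _ _ _ _
  · rw [cellMinor, windowMinor_zero _ _ _ _ (xSeq_injOn.mono (Set.Iio_subset_Iio hl))]
    simp

theorem cellMinor_corner (hμ : Monotone μ) (hl : l ≤ k) (hl₀ : 0 < l) (hlq : l < q) :
    cellMinor k m μ 0 l q = cellMinor k m μ 0 l (q - 1) * cellMinor k m μ 0 (l - 1) (q - 1) *
      (xSeq k m (l - 1) + ySeq k m (q - l - 1)) / cellMinor k m μ 0 (l - 1) (q - 2) := by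
  obtain ⟨l, rfl⟩ : ∃ i, l = i + 1 := Nat.exists_eq_add_one.mpr hl₀
  obtain ⟨a, rfl⟩ : ∃ a, q = l + 1 + (a + 1) := ⟨q - l - 2, by omega⟩
  refine eq_div_of_mul_eq (windowMinor_xSeq_ySeq_ne_zero hμ _ _ (by omega)) ?_
  have h := windowMinor_zero_succ_succ (xSeq k m) (ySeq k m) μ a
    (xSeq_injOn.mono (Set.Iio_subset_Iio hl))
  unfold cellMinor
  convert h using 4 <;> omega

theorem cellMinor_of_le (hμ : Monotone μ) (hs : s ≠ 0) (hq : s + l ≤ q)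
    (h : s ≤ μ (q - s - l)) : cellMinor k m μ s l q = cellMinor k m μ (s - 1) l q := by
  obtain ⟨s, rfl⟩ := Nat.exists_eq_succ_of_ne_zero hs
  refine (windowMinor_succ_of_lt _ _ hμ h l).trans ?_
  unfold cellMinor
  congr 1
  omega

theorem cellMinor_of_lt (hμ : Monotone μ) (hs : s ≠ 0) (hq : s + l ≤ q)
    (h : μ (q - s - 1) < s) : cellMinor k m μ s l q = cellMinor k m μ (s - 1) l (q - 1) := by
  obtain ⟨s, rfl⟩ := Nat.exists_eq_succ_of_ne_zero hs
  refine (windowMinor_succ_of_le _ _ hμ ?_).trans ?_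
  · refine Nat.le_of_lt_succ (lt_of_eq_of_lt ?_ h)
    congr 1
    omega
  · unfold cellMinor
    congr 1
    omega

theorem cellMinor_exchange (hμ : Monotone μ) (hl : l ≤ k) (hl₀ : 0 < l) (hs : s ≠ 0)
    (hq : s + l ≤ q) (h1 : μ (q - s - l) < s) (h2 : s ≤ μ (q - s - 1)) :
    cellMinor k m μ s l q =
      (cellMinor k m μ (s - 1) l (q - 1) * cellMinor k m μ s (l - 1) q +
        cellMinor k m μ (s - 1) l q * cellMinor k m μ s (l - 1) (q - 1)) /
      cellMinor k m μ (s - 1) (l - 1) (q - 1) := by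
  obtain ⟨s, rfl⟩ := Nat.exists_eq_succ_of_ne_zero hs
  obtain ⟨l, rfl⟩ : ∃ i, l = i + 1 := Nat.exists_eq_add_one.mpr hl₀
  obtain ⟨a, rfl⟩ : ∃ a, q = s + 1 + (l + 1) + a := Nat.exists_eq_add_of_le hq
  refine eq_div_of_mul_eq (windowMinor_xSeq_ySeq_ne_zero hμ _ _ (by omega)) ?_
  have ha : s + 1 + (l + 1) + a - (s + 1) - (l + 1) = a := by omega
  have hal : s + 1 + (l + 1) + a - (s + 1) - 1 = a + l := by omega
  rw [Nat.succ_eq_add_one, ha] at h1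
  rw [Nat.succ_eq_add_one, hal] at h2
  have h := windowMinor_exchange (xSeq k m) (ySeq k m) hμ (Nat.le_of_lt_succ h1) h2
  unfold cellMinor
  convert h using 4 <;> omega

theorem getD_cellValues_five (hl : l ≤ k) (h : s + l ≤ q) :
    (cellValues k m μ s l q).getD 5 0 = cellMinor k m μ s l q := by
  unfold cellValues
  split_ifs with h1 h2 h3 h4
  · omega
  · simp [h2]
  · subst h2
    simpa using (cellMinor_zero_of_eq hl (by omega)).symm
  all_goals simp

theorem nodeValue_node_five (hl : l ≤ k) (hq : q ≤ n) (h : s + l ≤ q) :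
    nodeValue k m n μ (node k n s l q 5) = cellMinor k m μ s l q := by
  rw [nodeValue_node hl hq (by decide), getD_cellValues_five hl h]

theorem holdsFrom_node_iff {v : ℕ → RatFun k m} {g₀ g₁ g₂ g₃ g₄ g₅ : Gate ℕ} :
    HoldsFrom v (node k n s l q 0) [g₀, g₁, g₂, g₃, g₄, g₅] ↔
      g₀.Holds v (node k n s l q 0) ∧ g₁.Holds v (node k n s l q 1) ∧
      g₂.Holds v (node k n s l q 2) ∧ g₃.Holds v (node k n s l q 3) ∧
      g₄.Holds v (node k n s l q 4) ∧ g₅.Holds v (node k n s l q 5) := by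
  simp [HoldsFrom, node]

theorem holdsFrom_unitGates {v : ℕ → RatFun k m}
    (h : ∀ j < 6, v (node k n s l q j) = 1) : HoldsFrom v (node k n s l q 0) unitGates := by
  refine holdsFrom_node_iff.mpr ?_
  simp [Gate.Holds, h]

theorem holdsFrom_copyGates {v : ℕ → RatFun k m} {source : ℕ}
    (hsource : source < node k n s l q 0) (h : ∀ j < 5, v (node k n s l q j) = 1)
    (h5 : v (node k n s l q 5) = v source) :
    HoldsFrom v (node k n s l q 0) (copyGates source (node k n s l q 0)) := by
  refine holdsFrom_node_iff.mpr ?_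
  have : node k n s l q 0 < node k n s l q 5 := by simp [node]
  simp [Gate.Holds, h, h5, this, hsource.trans this]

theorem holdsFrom_cornerGates (hμ : Monotone μ) (hn : n ≤ m + 1) (hl : l ≤ k) (hq : q ≤ n)
    (hl₀ : 0 < l) (hlq : l < q) :
    HoldsFrom (nodeValue k m n μ) (node k n 0 l q 0) (cornerGates k n l q) := by
  have hlt : ¬ q < 0 + l := by omega
  have hv (j : ℕ) (hj : j < 6) := nodeValue_node (m := m) (μ := μ) (s := 0) hl hq hj
  simp only [cellValues, if_neg hlt, if_pos (And.intro hl₀ hlq)] at hv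
  have h1 := nodeValue_node_five (m := m) (n := n) (μ := μ) (s := 0) (q := q - 1) hl
    (by omega) (by omega)
  have h2 := nodeValue_node_five (k := k) (m := m) (n := n) (μ := μ) (s := 0) (l := l - 1)
    (q := q - 1) (by omega) (by omega) (by omega)
  have h3 := nodeValue_node_five (k := k) (m := m) (n := n) (μ := μ) (s := 0) (l := l - 1)
    (q := q - 2) (by omega) (by omega) (by omega)
  refine holdsFrom_node_iff.mpr ⟨⟨by omega, ?_⟩, ⟨by omega, ?_⟩,
    ⟨Nat.add_lt_add_left (by decide) _, Nat.add_lt_add_left (by decide) _, ?_⟩,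
    ⟨node_lt_node le_rfl le_rfl (by omega) (by omega) (by decide),
      node_lt_node le_rfl (by omega) (by omega) (by omega) (by decide), ?_⟩,
    ⟨Nat.add_lt_add_left (by decide) _, Nat.add_lt_add_left (by decide) _, ?_⟩,
    ⟨Nat.add_lt_add_left (by decide) _,
      node_lt_node le_rfl (by omega) (by omega) (by omega) (by decide), ?_, ?_⟩⟩
  · rw [hv 0 (by decide)]
    exact dif_pos _
  · rw [hv 1 (by decide)]
    exact dif_pos _
  · rw [hv 0 (by decide), hv 1 (by decide), hv 2 (by decide)]
    rfl
  · rw [hv 3 (by decide), h1, h2]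
    rfl
  · rw [hv 2 (by decide), hv 3 (by decide), hv 4 (by decide)]
    rfl
  · rw [h3]
    exact windowMinor_xSeq_ySeq_ne_zero hμ _ _ (by omega)
  · rw [hv 4 (by decide), hv 5 (by decide), h3]
    exact cellMinor_corner hμ hl hl₀ hlq

theorem holdsFrom_exchangeGates (hμ : Monotone μ) (hl : l ≤ k) (hq : q ≤ n) (hs : s ≠ 0)
    (hsl : s + l ≤ q) (h1 : μ (q - s - l) < s) (h2 : s ≤ μ (q - s - 1)) :
    HoldsFrom (nodeValue k m n μ) (node k n s l q 0) (exchangeGates k n s l q) := by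
  have hl₀ : 0 < l := by
    by_contra! hl₀
    exact (h1.trans_le h2).not_ge (hμ (by omega))
  have hcopy : ¬ (s ≤ μ (q - s - l) ∨ μ (q - s - 1) < s) := by omega
  have hv (j : ℕ) (hj : j < 6) := nodeValue_node (m := m) (μ := μ) (s := s) hl hq hj
  simp only [cellValues, if_neg hsl.not_gt, if_neg hs, if_neg hcopy] at hv
  have hsource (s' l' q' : ℕ) (hl' : l' ≤ l) (hq' : q' ≤ q) (h : s' + l' ≤ q') :=
    nodeValue_node_five (m := m) (μ := μ) (hl'.trans hl) (hq'.trans hq) h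
  refine holdsFrom_node_iff.mpr ⟨⟨one_pos, ?_⟩, ⟨one_pos, ?_⟩,
    ⟨node_lt_node (by omega) le_rfl (by omega) (by omega) (by decide),
      node_lt_node le_rfl (by omega) le_rfl (by omega) (by decide), ?_⟩,
    ⟨node_lt_node (by omega) le_rfl le_rfl (by omega) (by decide),
      node_lt_node le_rfl (by omega) (by omega) (by omega) (by decide), ?_⟩,
    ⟨Nat.add_lt_add_left (by decide) _, Nat.add_lt_add_left (by decide) _, ?_⟩,
    ⟨Nat.add_lt_add_left (by decide) _,
      node_lt_node (by omega) (by omega) (by omega) (by omega) (by decide), ?_, ?_⟩⟩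
  · exact (hv 0 (by decide)).trans Nat.cast_one.symm
  · exact (hv 1 (by decide)).trans Nat.cast_one.symm
  · rw [hv 2 (by decide), hsource (s - 1) l (q - 1) le_rfl (by omega) (by omega),
      hsource s (l - 1) q (by omega) le_rfl (by omega)]
    rfl
  · rw [hv 3 (by decide), hsource (s - 1) l q le_rfl le_rfl (by omega),
      hsource s (l - 1) (q - 1) (by omega) (by omega) (by omega)]
    rfl
  · rw [hv 2 (by decide), hv 3 (by decide), hv 4 (by decide)]
    rfl
  · rw [hsource (s - 1) (l - 1) (q - 1) (by omega) (by omega) (by omega)]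
    exact windowMinor_xSeq_ySeq_ne_zero hμ _ _ (by omega)
  · rw [hv 4 (by decide), hv 5 (by decide),
      hsource (s - 1) (l - 1) (q - 1) (by omega) (by omega) (by omega)]
    exact cellMinor_exchange hμ hl hl₀ hs hsl h1 h2

theorem nodeValue_node_of_cellValues_eq (hl : l ≤ k) (hq : q ≤ n) {r : ℕ}
    {vs : List (RatFun k m)} (h : cellValues k m μ s l q = List.replicate r 1 ++ vs) (hr : r ≤ 6) :
    ∀ j < r, nodeValue k m n μ (node k n s l q j) = 1 := fun j hj => by
  rw [nodeValue_node hl hq (hj.trans_le hr), h, List.getD_append _ _ _ _ (by simpa using hj)]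
  simp [hj]

theorem holdsFrom_cell (hμ : Monotone μ) (hn : n ≤ m + 1) (hl : l ≤ k) (hq : q ≤ n) :
    HoldsFrom (nodeValue k m n μ) (node k n s l q 0) (cell k n μ s l q) := by
  have hcopy (s' q' : ℕ) (hs : s ≠ 0) (hsl : s + l ≤ q) (hs' : s' < s) (hq' : q' ≤ q)
      (hsl' : s' + l ≤ q') (hmoves : s ≤ μ (q - s - l) ∨ μ (q - s - 1) < s)
      (heq : cellMinor k m μ s l q = cellMinor k m μ s' l q') :
      HoldsFrom (nodeValue k m n μ) (node k n s l q 0)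
        (copyGates (node k n s' l q' 5) (node k n s l q 0)) := by
    refine holdsFrom_copyGates (node_lt_node hs'.le le_rfl hq' (by omega) (by decide))
      (nodeValue_node_of_cellValues_eq hl hq (vs := [cellMinor k m μ s l q]) ?_ (by decide)) ?_
    · rw [cellValues, if_neg hsl.not_gt, if_neg hs, if_pos hmoves]
      rfl
    · rw [nodeValue_node_five hl hq hsl, nodeValue_node_five hl (hq'.trans hq) hsl', heq]
  have hunit (h : cellValues k m μ s l q = List.replicate 6 1) :
      HoldsFrom (nodeValue k m n μ) (node k n s l q 0) unitGates :=
    holdsFrom_unitGates (nodeValue_node_of_cellValues_eq hl hq (vs := []) h le_rfl)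
  unfold cell
  split_ifs with h1 h2 h3 h4 h5
  · exact hunit (if_pos h1)
  · subst h2
    exact holdsFrom_cornerGates hμ hn hl hq h3.1 h3.2
  · exact hunit (by rw [cellValues, if_neg h1, if_pos h2, if_neg h3])
  · exact hcopy _ _ h2 (by omega) (by omega) le_rfl (by omega) (.inl h4)
      (cellMinor_of_le hμ h2 (by omega) h4)
  · exact hcopy _ _ h2 (by omega) (by omega) (by omega) (by omega) (.inr h5)
      (cellMinor_of_lt hμ h2 (by omega) h5)
  · exact holdsFrom_exchangeGates hμ hl hq h2 (by omega) (by omega) (by omega)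

theorem length_cell : (cell k n μ s l q).length = 6 := by
  unfold cell
  split_ifs <;> rfl

theorem circuit_succ (N : ℕ) : circuit k n μ (N + 1) = circuit k n μ N ++
    cell k n μ (coords k n N).1 (coords k n N).2.1 (coords k n N).2.2 := by
  simp [circuit, List.range_succ]

theorem length_circuit (N : ℕ) : (circuit k n μ N).length = 6 * N := by
  induction N with
  | zero => rfl
  | succ N ih => rw [circuit_succ, List.length_append, ih, length_cell, Nat.mul_succ]

theorem node_coords (N : ℕ) :
    node k n (coords k n N).1 (coords k n N).2.1 (coords k n N).2.2 0 = 6 * N := by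
  simp [node, coords, Nat.div_add_mod']

theorem holdsFrom_circuit (hμ : Monotone μ) (hn : n ≤ m + 1) (N : ℕ) :
    HoldsFrom (nodeValue k m n μ) 0 (circuit k n μ N) := by
  induction N with
  | zero => exact trivial
  | succ N ih =>
    rw [circuit_succ]
    refine ih.append ?_
    rw [length_circuit, zero_add, ← node_coords]
    exact holdsFrom_cell hμ hn (Nat.le_of_lt_succ (Nat.mod_lt _ k.succ_pos))
      (Nat.le_of_lt_succ (Nat.mod_lt _ n.succ_pos))

theorem circuit_computes_doubleSchur (hk : 0 < k) {lam : Fin k → ℕ} (h : Antitone lam)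
    (hn : n = k + lam ⟨0, hk⟩) :
    (circuit k n (reversedPart lam) ((lam ⟨0, hk⟩ + 1) * (k + 1) * (n + 1))).Computes
      (doubleSchur (n - 1) lam) := by
  have hμ := reversedPart_monotone hk h
  refine ⟨nodeValue k (n - 1) n (reversedPart lam), fun t ht => ?_, ?_, ?_⟩
  · simpa using (holdsFrom_circuit hμ (by omega) _).get t ht
  · rw [← List.length_pos_iff, length_circuit]
    positivity
  · have hlast : 6 * ((lam ⟨0, hk⟩ + 1) * (k + 1) * (n + 1)) - 1 =
        node k n (lam ⟨0, hk⟩) k n 5 := by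
      refine Nat.sub_eq_of_eq_add ?_
      unfold node
      ring
    rw [length_circuit, hlast, nodeValue_node_five le_rfl le_rfl (by omega)]
    subst hn
    rw [doubleSchur_eq_windowMinor hk h, cellMinor]
    congr 1
    omega

end Circuit

/-! ## Machine costs -/

theorem size_add_le (a b : ℕ) : (a + b).size ≤ a.size + b.size + 1 := by
  refine Nat.size_le.mpr ?_
  calc a + b < 2 ^ a.size + 2 ^ b.size := Nat.add_lt_add a.lt_size_self b.lt_size_self
    _ ≤ 2 ^ (a.size + b.size) + 2 ^ (a.size + b.size) := by
      gcongr <;> first | decide | omega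
    _ = 2 ^ (a.size + b.size + 1) := (Nat.two_pow_succ _).symm

theorem size_mul_le (a b : ℕ) : (a * b).size ≤ a.size + b.size := by
  rw [Nat.size_le, pow_add]
  exact Nat.mul_lt_mul'' a.lt_size_self b.lt_size_self

/-- All numbers stored in `s`, and the number of emitted nodes, have at most `L` bits, where
`L` is positive. -/
structure State.BitBounded (s : State) (L : ℕ) : Prop where
  pos : 0 < L
  reg : ∀ r, (s.reg r).size ≤ L
  mem : ∀ a, (s.mem a).size ≤ L
  out : s.out.length.size ≤ L

theorem State.BitBounded.mono {s : State} {L L' : ℕ} (h : s.BitBounded L) (hL : L ≤ L') :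
    s.BitBounded L' :=
  ⟨h.pos.trans_le hL, fun r => (h.reg r).trans hL, fun a => (h.mem a).trans hL, h.out.trans hL⟩

theorem size_update_le {f : ℕ → ℕ} {L : ℕ} (hf : ∀ b, (f b).size ≤ L) (a : ℕ) {x : ℕ}
    (hx : x.size ≤ L) (b : ℕ) : (Function.update f a x b).size ≤ L := by
  rw [Function.update_apply]
  split_ifs
  exacts [hx, hf b]

namespace Expr

/-- On numbers of at most `L` bits, the value of `e` has `O(L)` bits and its evaluation costs
`O(L ^ 2)`, with the constant `d`. -/
def BoundedBy (e : Expr) (d : ℕ) : Prop :=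
  ∀ (s : State) (L : ℕ), s.BitBounded L → (e.eval s).size ≤ d * L ∧ e.cost s ≤ d * L ^ 2

theorem boundedBy_lit (c : ℕ) : (lit c).BoundedBy (c.size + 1) := fun _ _ hs =>
  ⟨c.size.le_succ.trans (Nat.le_mul_of_pos_right _ hs.pos),
    Nat.le_mul_of_pos_right _ (pow_pos hs.pos 2)⟩

theorem boundedBy_reg (r : ℕ) : (reg r).BoundedBy 2 := fun s L hs => by
  have h := hs.reg r
  have hL := hs.pos
  refine ⟨?_, ?_⟩ <;> simp only [eval, cost] <;> nlinarith

theorem BoundedBy.mem {e : Expr} {d : ℕ} (he : e.BoundedBy d) :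
    (mem e).BoundedBy (2 * d + 2) := fun s L hs => by
  have h := hs.mem (e.eval s)
  obtain ⟨hsize, hcost⟩ := he s L hs
  have hL := hs.pos
  have hLL : L ≤ L ^ 2 := Nat.le_self_pow two_ne_zero L
  refine ⟨?_, ?_⟩ <;> simp only [eval, cost] <;> nlinarith

theorem BoundedBy.binary {e f g : Expr} {d d' : ℕ} (he : e.BoundedBy d) (hf : f.BoundedBy d')
    (hsize : ∀ s, (g.eval s).size ≤ (e.eval s).size + (f.eval s).size + 1)
    (hcost : ∀ s, g.cost s ≤
      e.cost s + f.cost s + ((e.eval s).size + 1) * ((f.eval s).size + 1)) :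
    g.BoundedBy (d + d' + (d + 1) * (d' + 1)) := fun s L hs => by
  obtain ⟨hes, hec⟩ := he s L hs
  obtain ⟨hfs, hfc⟩ := hf s L hs
  have hL := hs.pos
  constructor
  · calc (g.eval s).size ≤ d * L + d' * L + 1 * L := by have := hsize s; omega
      _ ≤ (d + d' + (d + 1) * (d' + 1)) * L := by
        rw [← add_mul, ← add_mul]
        gcongr
        exact Nat.succ_le_of_lt (by positivity)
  · calc g.cost s
        ≤ d * L ^ 2 + d' * L ^ 2 + (d * L + L) * (d' * L + L) :=
          (hcost s).trans (by gcongr <;> exact hL)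
      _ = (d + d' + (d + 1) * (d' + 1)) * L ^ 2 := by ring

theorem exists_boundedBy (e : Expr) : ∃ d, e.BoundedBy d := by
  induction e with
  | lit c => exact ⟨_, boundedBy_lit c⟩
  | reg r => exact ⟨_, boundedBy_reg r⟩
  | mem e ih =>
    obtain ⟨d, h⟩ := ih
    exact ⟨_, h.mem⟩
  | add e f ihe ihf =>
    obtain ⟨⟨d, he⟩, ⟨d', hf⟩⟩ := And.intro ihe ihf
    refine ⟨_, he.binary hf (fun s => size_add_le _ _) fun s => ?_⟩
    simp only [cost]
    nlinarith
  | sub e f ihe ihf =>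
    obtain ⟨⟨d, he⟩, ⟨d', hf⟩⟩ := And.intro ihe ihf
    refine ⟨_, he.binary hf (fun s => ?_) fun s => ?_⟩
    · exact (Nat.size_le_size (Nat.sub_le _ _)).trans (by omega)
    · simp only [cost]
      nlinarith
  | mul e f ihe ihf =>
    obtain ⟨⟨d, he⟩, ⟨d', hf⟩⟩ := And.intro ihe ihf
    exact ⟨_, he.binary hf (fun s => (size_mul_le _ _).trans (Nat.le_succ _)) fun s => le_rfl⟩

theorem exists_sum_cost_le (es : List Expr) : ∃ d, ∀ (s : State) (L : ℕ), s.BitBounded L →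
    (es.map (cost s)).sum ≤ d * L ^ 2 := by
  induction es with
  | nil => exact ⟨0, fun s L _ => by simp⟩
  | cons e es ih =>
    obtain ⟨d, hd⟩ := ih
    obtain ⟨d', hd'⟩ := e.exists_boundedBy
    refine ⟨d' + d, fun s L hs => ?_⟩
    rw [List.map_cons, List.sum_cons, add_mul]
    exact Nat.add_le_add (hd' s L hs).2 (hd s L hs)

theorem eval_out (s : State) (c : Circuit) (e : Expr) :
    e.eval { s with out := c } = e.eval s := by
  induction e <;> simp_all only [eval]

end Expr

/-- The program `p`, started in the state `s`, halts in the state `s'` at a cost of at most `T`. -/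
def RunsWithin (w : ℕ) (p : Program) (s s' : State) (T : ℕ) : Prop :=
  ∃ t ≤ T, Exec w p s s' t

namespace RunsWithin

variable {w : ℕ} {p q : Program} {s s' s'' : State} {T T' : ℕ}

theorem mono (h : RunsWithin w p s s' T) (hT : T ≤ T') : RunsWithin w p s s' T' := by
  obtain ⟨t, ht, hrun⟩ := h
  exact ⟨t, ht.trans hT, hrun⟩

theorem seq (hp : RunsWithin w p s s' T) (hq : RunsWithin w q s' s'' T') :
    RunsWithin w (.seq p q) s s'' (T + T') := by
  obtain ⟨t, ht, hp⟩ := hp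
  obtain ⟨t', ht', hq⟩ := hq
  exact ⟨_, Nat.add_le_add ht ht', hp.seq hq⟩

theorem loop {e : Expr} {σ : ℕ → State} {N : ℕ}
    (hbody : ∀ i < N, RunsWithin w p (σ i) (σ (i + 1)) T) (hcost : ∀ i ≤ N, e.cost (σ i) ≤ T')
    (htrue : ∀ i < N, e.eval (σ i) ≠ 0) (hfalse : e.eval (σ N) = 0) :
    RunsWithin w (.loop e p) (σ 0) (σ N) ((N + 1) * (T + T' + 1)) := by
  induction N generalizing σ with
  | zero => exact ⟨_, by have := hcost 0 le_rfl; omega, .loop_false hfalse⟩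
  | succ N ih =>
    obtain ⟨t, ht, hfirst⟩ := hbody 0 N.succ_pos
    obtain ⟨t', ht', hrest⟩ := ih (σ := fun i => σ (i + 1))
      (fun i hi => hbody (i + 1) (Nat.succ_lt_succ hi))
      (fun i hi => hcost (i + 1) (Nat.succ_le_succ hi))
      (fun i hi => htrue (i + 1) (Nat.succ_lt_succ hi)) hfalse
    refine ⟨_, ?_, .loop_true (htrue 0 N.succ_pos) hfirst hrest⟩
    have hcost₀ := hcost 0 (Nat.zero_le _)
    rw [add_mul (N + 1)]
    omega

end RunsWithin

namespace Program

/-- The program contains no loops. -/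
def LoopFree : Program → Prop
  | seq p q => p.LoopFree ∧ q.LoopFree
  | ite _ p q => p.LoopFree ∧ q.LoopFree
  | loop _ _ => False
  | _ => True

/-- The final state of a run of a program without loops; a loop is treated as `skip`. -/
def run : Program → State → State
  | skip, s => s
  | set r e, s => { s with reg := Function.update s.reg r (e.eval s) }
  | store addr e, s => { s with mem := Function.update s.mem (addr.eval s) (e.eval s) }
  | emit g, s => { s with out := s.out ++ [g.map (Expr.eval s)] }
  | seq p q, s => q.run (p.run s)
  | ite e p q, s => if e.eval s ≠ 0 then p.run s else q.run s
  | loop _ _, s => s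

/-- Started on numbers of at most `L` bits, `p` halts in the state given by `Program.run`, in which
all numbers have `O(L)` bits, at a cost of `O(L ^ 2 + w ^ 2)`, with the constant `d`. -/
def BoundedBy (p : Program) (d : ℕ) : Prop :=
  ∀ (w : ℕ) (s : State) (L : ℕ), s.BitBounded L →
    RunsWithin w p s (p.run s) (d * (L ^ 2 + w ^ 2)) ∧ (p.run s).BitBounded (d * L)

theorem BoundedBy.mono {p : Program} {d d' : ℕ} (h : p.BoundedBy d) (hd : d ≤ d') :
    p.BoundedBy d' := fun w s L hs =>
  ⟨(h w s L hs).1.mono (Nat.mul_le_mul_right _ hd),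
    (h w s L hs).2.mono (Nat.mul_le_mul_right _ hd)⟩

theorem boundedBy_skip : skip.BoundedBy 1 := fun w s L hs =>
  ⟨⟨1, Nat.succ_le_of_lt (by have := hs.pos; positivity), .skip s⟩, hs.mono (one_mul L).ge⟩

theorem boundedBy_set (r : ℕ) {e : Expr} {d : ℕ} (he : e.BoundedBy d) :
    (set r e).BoundedBy (2 * d + 1) := fun w s L hs => by
  obtain ⟨hsize, hcost⟩ := he s L hs
  have hL := hs.pos
  have hLL : L ≤ L ^ 2 := Nat.le_self_pow two_ne_zero L
  have hs' := hs.mono (Nat.le_mul_of_pos_left L (2 * d).succ_pos)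
  refine ⟨⟨_, ?_, .set s r e⟩, hs'.pos, size_update_le hs'.reg r ?_, hs'.mem, hs'.out⟩
  · nlinarith
  · nlinarith

theorem boundedBy_store {e f : Expr} {d d' : ℕ} (he : e.BoundedBy d) (hf : f.BoundedBy d') :
    (store e f).BoundedBy (2 * d + 2 * d' + 1) := fun w s L hs => by
  obtain ⟨hes, hec⟩ := he s L hs
  obtain ⟨hfs, hfc⟩ := hf s L hs
  have hL := hs.pos
  have hLL : L ≤ L ^ 2 := Nat.le_self_pow two_ne_zero L
  have hs' := hs.mono (Nat.le_mul_of_pos_left L (2 * d + 2 * d').succ_pos)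
  refine ⟨⟨_, ?_, .store s e f⟩, hs'.pos, hs'.reg, size_update_le hs'.mem _ ?_, hs'.out⟩
  · nlinarith
  · nlinarith

theorem boundedBy_emit {g : Gate Expr} {d : ℕ}
    (hg : ∀ (s : State) (L : ℕ), s.BitBounded L →
      (g.operands.map (Expr.cost s)).sum ≤ d * L ^ 2) :
    (emit g).BoundedBy (d + 3) := fun w s L hs => by
  have hcost := hg s L hs
  have hout := hs.out
  have hL := hs.pos
  have hLL : L ≤ L ^ 2 := Nat.le_self_pow two_ne_zero L
  have hs' := hs.mono (Nat.le_mul_of_pos_left L (d + 2).succ_pos)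
  refine ⟨⟨_, ?_, .emit s g⟩, hs'.pos, hs'.reg, hs'.mem, ?_⟩
  · nlinarith
  · have hsize := size_add_le s.out.length 1
    simp only [run, List.length_append, List.length_singleton]
    rw [Nat.size_one] at hsize
    nlinarith

theorem BoundedBy.seq {p q : Program} {d d' : ℕ} (hp : p.BoundedBy d) (hq : q.BoundedBy d') :
    (seq p q).BoundedBy (d + d' * d ^ 2 + d' * d) := fun w s L hs => by
  obtain ⟨hrun, hs'⟩ := hp w s L hs
  obtain ⟨hrun', hs''⟩ := hq w _ _ hs'
  have hd : 0 < d := Nat.pos_of_mul_pos_right hs'.pos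
  refine ⟨(hrun.seq hrun').mono ?_, hs''.mono ?_⟩
  · have hdw : d' * w ^ 2 ≤ d' * d ^ 2 * w ^ 2 :=
      Nat.mul_le_mul_right _ (Nat.le_mul_of_pos_right _ (pow_pos hd 2))
    nlinarith [Nat.zero_le (d' * d * (L ^ 2 + w ^ 2))]
  · rw [← mul_assoc]
    exact Nat.mul_le_mul_right _ (Nat.le_add_left _ _)

theorem BoundedBy.ite {e : Expr} {p q : Program} {c d : ℕ} (he : e.BoundedBy c)
    (hp : p.BoundedBy d) (hq : q.BoundedBy d) : (ite e p q).BoundedBy (c + d + 1) :=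
    fun w s L hs => by
  have hcost := (he s L hs).2
  have hL : 0 < L ^ 2 := pow_pos hs.pos 2
  have hd : d * L ≤ (c + d + 1) * L := Nat.mul_le_mul_right _ (by omega)
  have htotal {t : ℕ} (ht : t ≤ d * (L ^ 2 + w ^ 2)) :
      e.cost s + t + 1 ≤ (c + d + 1) * (L ^ 2 + w ^ 2) := by nlinarith
  rw [run]
  split_ifs with h
  · obtain ⟨⟨t, ht, hrun⟩, hs'⟩ := hp w s L hs
    exact ⟨⟨_, htotal ht, .ite_true h hrun⟩, hs'.mono hd⟩
  · obtain ⟨⟨t, ht, hrun⟩, hs'⟩ := hq w s L hs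
    exact ⟨⟨_, htotal ht, .ite_false (not_not.mp h) hrun⟩, hs'.mono hd⟩

theorem LoopFree.exists_boundedBy {p : Program} (hp : p.LoopFree) : ∃ d, p.BoundedBy d := by
  induction p with
  | skip => exact ⟨_, boundedBy_skip⟩
  | set r e =>
    obtain ⟨d, he⟩ := e.exists_boundedBy
    exact ⟨_, boundedBy_set r he⟩
  | store e f =>
    obtain ⟨⟨d, he⟩, ⟨d', hf⟩⟩ := And.intro e.exists_boundedBy f.exists_boundedBy
    exact ⟨_, boundedBy_store he hf⟩
  | emit g =>
    obtain ⟨d, hg⟩ := Expr.exists_sum_cost_le g.operands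
    exact ⟨_, boundedBy_emit hg⟩
  | seq p q ihp ihq =>
    obtain ⟨⟨d, hp⟩, ⟨d', hq⟩⟩ := And.intro (ihp hp.1) (ihq hp.2)
    exact ⟨_, hp.seq hq⟩
  | ite e p q ihp ihq =>
    obtain ⟨c, he⟩ := e.exists_boundedBy
    obtain ⟨⟨d, hp⟩, ⟨d', hq⟩⟩ := And.intro (ihp hp.1) (ihq hp.2)
    exact ⟨_, BoundedBy.ite he (hp.mono (le_max_left d d')) (hq.mono (le_max_right d d'))⟩
  | loop e p => exact hp.elim

/-- The program which emits the gates of a list one after another. -/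
def emits : List (Gate Expr) → Program
  | [] => skip
  | g :: gs => seq (emit g) (emits gs)

theorem loopFree_emits (gs : List (Gate Expr)) : (emits gs).LoopFree := by
  induction gs with
  | nil => trivial
  | cons g gs ih => exact ⟨trivial, ih⟩

theorem run_emits (gs : List (Gate Expr)) (s : State) :
    (emits gs).run s = { s with out := s.out ++ gs.map (Gate.map (Expr.eval s)) } := by
  induction gs generalizing s with
  | nil => simp [emits, run]
  | cons g gs ih =>
    have heval : Expr.eval { s with out := s.out ++ [g.map (Expr.eval s)] } = Expr.eval s :=
      funext fun e => Expr.eval_out _ _ _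
    simp [emits, run, ih, heval]

theorem run_ite {α : Type*} {e : Expr} {p q : Program} {s : State} {P : Prop} [Decidable P]
    {a b : α} (f : α → State) (hP : e.eval s ≠ 0 ↔ P) (hp : p.run s = f a) (hq : q.run s = f b) :
    (ite e p q).run s = f (if P then a else b) := by
  rw [run, apply_ite f, hp, hq]
  exact if_congr hP rfl rfl

end Program

/-! ## The program -/

section Program

instance : Add Expr := ⟨.add⟩

instance : Sub Expr := ⟨.sub⟩

instance : Mul Expr := ⟨.mul⟩

instance (c : ℕ) : OfNat Expr c := ⟨.lit c⟩

/-- The input `k` in the control of `schurProgram`. -/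
def kExpr : Expr := .reg 0

/-- The number `n = k + λ_1` in the control of `schurProgram`. -/
def nExpr : Expr := kExpr + .mem 0

/-- The counterpart of `reversedPart` in the control of `schurProgram`. -/
def partExpr (i : Expr) : Expr := .mem (kExpr - 1 - i)

/-- The loop counter `s` of `schurProgram`. -/
def sExpr : Expr := .reg 1

/-- The loop counter `l` of `schurProgram`. -/
def lExpr : Expr := .reg 2

/-- The loop counter `q` of `schurProgram`. -/
def qExpr : Expr := .reg 3

open Program in
/-- The counterpart of `cell`, for the values of the loop counters. -/
def cellProgram : Program :=
  .ite (sExpr + lExpr - qExpr) (emits unitGates)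
    (.ite (1 - sExpr)
      (.ite (lExpr * (qExpr - lExpr)) (emits (cornerGates kExpr nExpr lExpr qExpr))
        (emits unitGates))
      (.ite (partExpr (qExpr - sExpr - lExpr) + 1 - sExpr)
        (emits (copyGates (node kExpr nExpr (sExpr - 1) lExpr qExpr 5)
          (node kExpr nExpr sExpr lExpr qExpr 0)))
        (.ite (sExpr - partExpr (qExpr - sExpr - 1))
          (emits (copyGates (node kExpr nExpr (sExpr - 1) lExpr (qExpr - 1) 5)
            (node kExpr nExpr sExpr lExpr qExpr 0)))
          (emits (exchangeGates kExpr nExpr sExpr lExpr qExpr)))))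

/-- The coordinates of the cell after `(s, l, q)`. -/
def nextCoords (k n : ℕ) : ℕ × ℕ × ℕ → ℕ × ℕ × ℕ := fun (s, l, q) =>
  if q < n then (s, l, q + 1) else if l < k then (s, l + 1, 0) else (s + 1, 0, 0)

/-- The counterpart of `nextCoords`, for the values of the loop counters. -/
def nextCoordsProgram : Program :=
  .ite (nExpr - qExpr) (.set 3 (qExpr + 1))
    (.ite (kExpr - lExpr) (.seq (.set 2 (lExpr + 1)) (.set 3 0))
      (.seq (.set 1 (sExpr + 1)) (.seq (.set 2 0) (.set 3 0))))

/-- The test whether `s ≤ λ_1`. -/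
def cellTest : Expr := .mem 0 + 1 - sExpr

/-- Emit the cells `(s, l, q)` with `s ≤ λ_1`, `l ≤ k`, `q ≤ n` in lexicographic order. -/
def schurProgram : Program := .loop cellTest (.seq cellProgram nextCoordsProgram)

/-- The states in a run of `schurProgram`: the input is never changed, the loop counters are
`v = (s, l, q)`, and `c` has been emitted. -/
def controlState {k : ℕ} (lam : Fin k → ℕ) (v : ℕ × ℕ × ℕ) (c : Circuit) : State where
  reg
    | 0 => k
    | 1 => v.1
    | 2 => v.2.1
    | 3 => v.2.2
    | _ => 0
  mem := (initState lam).mem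
  out := c

variable {k : ℕ} (lam : Fin k → ℕ)

theorem initState_eq : initState lam = controlState lam (0, 0, 0) [] := by
  unfold initState controlState
  congr 1
  funext r
  rcases r with _ | _ | _ | _ | r <;> rfl

theorem coords_succ (k n t : ℕ) : coords k n (t + 1) = nextCoords k n (coords k n t) := by
  obtain ⟨s, l, q, hl, hq, rfl⟩ :
      ∃ s l q, l ≤ k ∧ q ≤ n ∧ t = (s * (k + 1) + l) * (n + 1) + q :=
    ⟨_, _, _, Nat.le_of_lt_succ (Nat.mod_lt _ k.succ_pos),
      Nat.le_of_lt_succ (Nat.mod_lt _ n.succ_pos), by rw [Nat.div_add_mod', Nat.div_add_mod']⟩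
  rw [coords_index hl hq]
  simp only [nextCoords]
  split_ifs with hqn hlk
  · exact coords_index hl hqn
  · obtain rfl : q = n := by omega
    rw [← coords_index (l := l + 1) hlk (Nat.zero_le q)]
    congr 1
    ring
  · obtain ⟨rfl, rfl⟩ : q = n ∧ l = k := by omega
    rw [← coords_index (Nat.zero_le l) (Nat.zero_le q)]
    congr 1
    ring

theorem run_nextCoordsProgram (v : ℕ × ℕ × ℕ) (c : Circuit) :
    nextCoordsProgram.run (controlState lam v c) =
      controlState lam (nextCoords k (k + (initState lam).mem 0) v) c := by
  refine Program.run_ite (fun v => controlState lam v c) Nat.sub_ne_zero_iff_lt ?_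
    (Program.run_ite (fun v => controlState lam v c) Nat.sub_ne_zero_iff_lt ?_ ?_)
  all_goals
    unfold controlState
    simp only [Program.run]
    congr 1
    funext r
    rcases r with _ | _ | _ | _ | r <;> rfl

theorem run_cellProgram (s l q : ℕ) (c : Circuit) :
    cellProgram.run (controlState lam (s, l, q) c) = controlState lam (s, l, q)
      (c ++ cell k (k + (initState lam).mem 0) (reversedPart lam) s l q) := by
  have hemits (gs) := Program.run_emits gs (controlState lam (s, l, q) c)
  refine Program.run_ite (fun b => controlState lam (s, l, q) (c ++ b)) Nat.sub_ne_zero_iff_lt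
    (hemits _) ?_
  refine Program.run_ite (fun b => controlState lam (s, l, q) (c ++ b)) ?_ ?_ ?_
  · exact Nat.sub_ne_zero_iff_lt.trans Nat.lt_one_iff
  · refine Program.run_ite (fun b => controlState lam (s, l, q) (c ++ b)) ?_
      (hemits _) (hemits _)
    exact mul_ne_zero_iff.trans (and_congr Nat.pos_iff_ne_zero.symm Nat.sub_ne_zero_iff_lt)
  refine Program.run_ite (fun b => controlState lam (s, l, q) (c ++ b)) ?_ (hemits _)
    (Program.run_ite (fun b => controlState lam (s, l, q) (c ++ b)) Nat.sub_ne_zero_iff_lt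
      (hemits _) (hemits _))
  exact Nat.sub_ne_zero_iff_lt.trans Nat.lt_succ_iff

theorem run_step {n : ℕ} (hn : n = k + (initState lam).mem 0) (t : ℕ) :
    (Program.seq cellProgram nextCoordsProgram).run
        (controlState lam (coords k n t) (circuit k n (reversedPart lam) t)) =
      controlState lam (coords k n (t + 1)) (circuit k n (reversedPart lam) (t + 1)) := by
  subst hn
  rw [Program.run, run_cellProgram, run_nextCoordsProgram, ← coords_succ, ← circuit_succ]

theorem loopFree_step : (Program.seq cellProgram nextCoordsProgram).LoopFree := by
  simp [cellProgram, nextCoordsProgram, Program.LoopFree, Program.loopFree_emits]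

theorem eval_cellTest_ne_zero_iff {n t : ℕ} (c : Circuit) :
    cellTest.eval (controlState lam (coords k n t) c) ≠ 0 ↔
      t < ((initState lam).mem 0 + 1) * (k + 1) * (n + 1) := by
  rw [← Nat.div_lt_iff_lt_mul n.succ_pos, ← Nat.div_lt_iff_lt_mul k.succ_pos]
  exact Nat.sub_ne_zero_iff_lt

variable {lam} {n : ℕ}

theorem cellCount_le {r : ℕ} (hk : 0 < k) (hn : n = k + r) :
    (r + 1) * (k + 1) * (n + 1) ≤ 4 * n ^ 3 :=
  calc (r + 1) * (k + 1) * (n + 1) ≤ n * (2 * n) * (2 * n) := by gcongr <;> omega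
    _ = 4 * n ^ 3 := by ring

theorem controlState_bitBounded (hk : 0 < k) (hlam : Antitone lam) {t : ℕ}
    (hn : n = k + lam ⟨0, hk⟩) (ht : t ≤ (lam ⟨0, hk⟩ + 1) * (k + 1) * (n + 1)) :
    (controlState lam (coords k n t) (circuit k n (reversedPart lam) t)).BitBounded
      (8 * n.size) := by
  have hsize {a : ℕ} (ha : a ≤ 24 * n ^ 3) : a.size ≤ 8 * n.size := by
    have hpos : 0 < n.size := Nat.size_pos.mpr (by omega)
    calc a.size ≤ (24 * (n * n * n)).size := Nat.size_le_size (by convert ha using 2; ring)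
      _ ≤ Nat.size 24 + (n.size + n.size + n.size) := by
        refine (size_mul_le _ _).trans ?_
        gcongr
        refine (size_mul_le _ _).trans ?_
        gcongr
        exact size_mul_le _ _
      _ ≤ 8 * n.size := by
        have : Nat.size 24 = 5 := by decide
        omega
  have hn3 : n ≤ n ^ 3 := Nat.le_self_pow three_ne_zero n
  have htn := ht.trans (cellCount_le hk hn)
  refine ⟨?_, fun r => hsize ?_, fun a => hsize ?_, hsize ?_⟩
  · have : 0 < n.size := Nat.size_pos.mpr (by omega)
    positivity
  · have hs : t / (n + 1) / (k + 1) ≤ t := (Nat.div_le_self _ _).trans (Nat.div_le_self _ _)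
    have hl : t / (n + 1) % (k + 1) < k + 1 := Nat.mod_lt _ k.succ_pos
    have hq : t % (n + 1) < n + 1 := Nat.mod_lt _ n.succ_pos
    rcases r with _ | _ | _ | _ | r <;> simp only [controlState, coords] <;> omega
  · simp only [controlState, initState]
    split_ifs with ha
    · have hle : lam ⟨a, ha⟩ ≤ lam ⟨0, hk⟩ := hlam (Nat.zero_le a)
      omega
    · exact Nat.zero_le _
  · simp only [controlState, length_circuit]
    omega

theorem exists_runsWithin_schurProgram : ∃ d, ∀ (w k n : ℕ) (hk : 0 < k) (lam : Fin k → ℕ),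
    Antitone lam → n = k + lam ⟨0, hk⟩ → ∃ s : State,
      s.out = circuit k n (reversedPart lam) ((lam ⟨0, hk⟩ + 1) * (k + 1) * (n + 1)) ∧
      RunsWithin w schurProgram (initState lam) s (d * n ^ 3 * (n.size ^ 2 + w ^ 2)) := by
  obtain ⟨d, hstep⟩ := loopFree_step.exists_boundedBy
  obtain ⟨d', htest⟩ := cellTest.exists_boundedBy
  refine ⟨320 * (d + d' + 1), fun w k n hk lam hlam hn => ?_⟩
  set N := (lam ⟨0, hk⟩ + 1) * (k + 1) * (n + 1) with hN
  have hmem : (initState lam).mem 0 = lam ⟨0, hk⟩ := dif_pos hk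
  let σ (t : ℕ) := controlState lam (coords k n t) (circuit k n (reversedPart lam) t)
  have hσ (t : ℕ) (ht : t ≤ N) := controlState_bitBounded hk hlam hn ht
  have hloop : RunsWithin w schurProgram (σ 0) (σ N)
      ((N + 1) * (d * ((8 * n.size) ^ 2 + w ^ 2) + d' * (8 * n.size) ^ 2 + 1)) := by
    refine .loop (fun t ht => ?_) (fun t ht => (htest _ _ (hσ t ht)).2) (fun t ht => ?_) ?_
    · have h := (hstep w _ _ (hσ t ht.le)).1
      rwa [run_step lam (by rw [hmem, hn])] at h
    · rw [eval_cellTest_ne_zero_iff, hmem]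
      exact ht
    · rw [← not_ne_iff, eval_cellTest_ne_zero_iff, hmem, hN]
      exact lt_irrefl _
  have hinit : initState lam = σ 0 := by
    rw [initState_eq]
    simp [σ, coords, circuit]
  refine ⟨σ N, rfl, hinit ▸ hloop.mono ?_⟩
  have hNn : N + 1 ≤ 5 * n ^ 3 := by
    have hle := cellCount_le hk hn
    have hpos : 0 < n ^ 3 := Nat.pow_pos (by omega)
    omega
  have hpos : 0 < n.size ^ 2 := Nat.pow_pos (Nat.size_pos.mpr (by omega))
  calc (N + 1) * (d * ((8 * n.size) ^ 2 + w ^ 2) + d' * (8 * n.size) ^ 2 + 1)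
      ≤ 5 * n ^ 3 * (64 * ((d + d' + 1) * (n.size ^ 2 + w ^ 2))) := by
        refine Nat.mul_le_mul hNn ?_
        nlinarith
    _ = 320 * (d + d' + 1) * n ^ 3 * (n.size ^ 2 + w ^ 2) := by ring

end Program

end DoubleSchur

/-- One program (the algorithm) handles all partitions `λ = (λ_1 ≥ … ≥ λ_k ≥ 0)`. With
`n = k + λ_1`, its run on `λ` executes a subtraction-free circuit of size `O(n ^ 3)` that computes
`s_λ(x_1, …, x_k | y)`, and costs `O(n ^ 3 log ^ 2 n)` bit operations when the arithmetic is done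
on numbers of `A * log n = O(log n)` bits, for whatever constant `A`. -/
theorem theorem2p3 :
    ∃ P : DoubleSchur.Program, ∀ A : ℕ, ∃ C : ℕ,
      ∀ (k n : ℕ) (hk : 0 < k) (lam : Fin k → ℕ), Antitone lam → n = k + lam ⟨0, hk⟩ →
        ∃ (s : DoubleSchur.State) (t : ℕ),
          DoubleSchur.Exec (A * n.size) P (DoubleSchur.initState lam) s t ∧
          s.out.Computes (DoubleSchur.doubleSchur (n - 1) lam) ∧
          s.out.length ≤ C * n ^ 3 ∧
          t ≤ C * n ^ 3 * n.size ^ 2 := by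
  obtain ⟨d, hd⟩ := DoubleSchur.exists_runsWithin_schurProgram
  refine ⟨DoubleSchur.schurProgram, fun A => ⟨d * (1 + A ^ 2) + 24, ?_⟩⟩
  intro k n hk lam hlam hn
  obtain ⟨s, hout, t, ht, hrun⟩ := hd (A * n.size) k n hk lam hlam hn
  refine ⟨s, t, hrun, ?_, ?_, ?_⟩
  · rw [hout]
    exact DoubleSchur.circuit_computes_doubleSchur hk hlam hn
  · rw [hout, DoubleSchur.length_circuit]
    linarith [DoubleSchur.cellCount_le hk hn, Nat.zero_le (d * (1 + A ^ 2) * n ^ 3)]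
  · calc t ≤ d * n ^ 3 * (n.size ^ 2 + (A * n.size) ^ 2) := ht
      _ = d * (1 + A ^ 2) * n ^ 3 * n.size ^ 2 := by ring
      _ ≤ _ := by gcongr; omega
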